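/- Let $n\ge 0$ and let $\mathcal G_0$ be the ring (without unit) of germs at $0\in\mathbb R^n$ of functions $f:(\mathbb R^n,0)\to(\mathbb R,0)$, not assumed continuous, that are bounded on some neighbourhood of $0$. Let ${}^*\mathbb R=\mathbb R^{I}/\mathcal U$ be the ultrapower of $\mathbb R$ by an ultrafilter $\mathcal U$ on a set $I$, similarly ${}^*\mathbb R^n$, and let $\delta\in{}^*\mathbb R$ be a positive infinitesimal. Put $B_\delta=\{\xi\in{}^*\mathbb R^n:|\xi|\le\delta\}$. For $[f]\in\mathcal G_0$ put $\|{}^*f\|_\delta=\sup_{\xi\in B_\delta}|{}^*f(\xi)|\in{}^*\mathbb R$; this supremum exists and depends only on the germ $[f]$. Let $\mathcal N_\delta=\{\|{}^*g\|_\delta:[g]\in\mathcal G_0\}$, and for $\mathfrak r\in\mathcal N_\delta$ with $\mathfrak r>0$ let $U_{\mathfrak r}=\{[f]\in\mathcal G_0:\|{}^*f\|_\delta<\mathfrak r\}$. Let $\tau=\tau^\delta$ be the topology on $\mathcal G_0$ generated by all translates $U_{\mathfrak r}+[f]$, where $[f]\in\mathcal G_0$, $\mathfrak r\in\mathcal N_\delta$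 and $\mathfrak r>0$. Proposition. For every such $n$, ${}^*\mathbb R$ and $\delta$, $(\mathcal G_0,\tau)$ is a Hausdorff topological ring: addition, negation and multiplication are continuous (addition and multiplication jointly), and distinct germs have disjoint neighbourhoods. -/

import Mathlib

open Filter Topology

noncomputable section

namespace GermTopology

/-- The ring `𝒢₀` (without unit) of germs at `0 ∈ ℝⁿ` of real functions that vanish at `0` and are
bounded on some neighbourhood of `0`. No continuity is required. -/
def germRing (n : ℕ) : NonUnitalSubring (Germ (𝓝 (0 : EuclideanSpace ℝ (Fin n))) ℝ) where
  carrier := {φ | φ.value = 0 ∧ ∃ C : ℝ, φ.LiftPred fun y => |y| ≤ C}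
  zero_mem' := ⟨rfl, 0, Germ.liftPred_const (by simp)⟩
  add_mem' := by
    rintro a b ⟨ha, A, hA⟩ ⟨hb, B, hB⟩
    induction a using Germ.inductionOn with | _ f
    induction b using Germ.inductionOn with | _ g
    refine ⟨(congrArg₂ (· + ·) ha hb : f 0 + g 0 = 0 + 0).trans (add_zero 0), A + B, ?_⟩
    rw [Germ.liftPred_coe] at hA hB
    rw [← Germ.coe_add, Germ.liftPred_coe]
    filter_upwards [hA, hB] with x h1 h2
    exact (abs_add_le _ _).trans (add_le_add h1 h2)
  neg_mem' := by
    rintro a ⟨ha, A, hA⟩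
    induction a using Germ.inductionOn with | _ f
    refine ⟨(congrArg (- ·) ha : - f 0 = - 0).trans neg_zero, A, ?_⟩
    rw [Germ.liftPred_coe] at hA
    rw [← Germ.coe_neg, Germ.liftPred_coe]
    filter_upwards [hA] with x h1
    simpa using h1
  mul_mem' := by
    rintro a b ⟨ha, A, hA⟩ ⟨hb, B, hB⟩
    induction a using Germ.inductionOn with | _ f
    induction b using Germ.inductionOn with | _ g
    refine ⟨(congrArg₂ (· * ·) ha hb : f 0 * g 0 = 0 * 0).trans (mul_zero 0), A * B, ?_⟩
    rw [Germ.liftPred_coe] at hA hB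
    rw [← Germ.coe_mul, Germ.liftPred_coe]
    filter_upwards [hA, hB] with x h1 h2
    rw [Pi.mul_apply, abs_mul]
    exact mul_le_mul h1 h2 (abs_nonneg _) ((abs_nonneg _).trans h1)

variable {ι : Type*} {𝓤 : Ultrafilter ι} {n : ℕ}

/-- `δ` is a positive infinitesimal of the ultrapower `*ℝ = ℝ^ι / 𝓤`. -/
def IsPosInfinitesimal (δ : Germ (𝓤 : Filter ι) ℝ) : Prop :=
  0 < δ ∧ ∀ r : ℝ, 0 < r → δ < (r : Germ (𝓤 : Filter ι) ℝ)

/-- The ball `B_δ = {ξ ∈ *ℝⁿ : |ξ| ≤ δ}`. -/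
def starBall (n : ℕ) (δ : Germ (𝓤 : Filter ι) ℝ) :
    Set (Germ (𝓤 : Filter ι) (EuclideanSpace ℝ (Fin n))) :=
  {ξ | ξ.map (fun x => ‖x‖) ≤ δ}

/-- Points of an infinitesimal ball lie in the monad of `0`. -/
theorem tendsto_of_mem_starBall {δ : Germ (𝓤 : Filter ι) ℝ} (hδ : IsPosInfinitesimal δ)
    {ξ : Germ (𝓤 : Filter ι) (EuclideanSpace ℝ (Fin n))} (hξ : ξ ∈ starBall n δ) :
    ξ.Tendsto (𝓝 0) := by
  induction ξ using Germ.inductionOn with | _ x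
  rw [Germ.coe_tendsto, Metric.tendsto_nhds]
  intro r hr
  have h : ((fun i => ‖x i‖ : ι → ℝ) : Germ (𝓤 : Filter ι) ℝ) < ((fun _ => r : ι → ℝ) :) :=
    lt_of_le_of_lt hξ (hδ.2 r hr)
  simpa [dist_zero_right] using Germ.coe_lt.1 h

/-- The value `*f(ξ)`, at a point `ξ` of an infinitesimal ball, of the transfer of a function `f`
with germ `φ` at `0`: if `ξ` is represented by `x : ι → ℝⁿ` then `*f(ξ)` is represented by
`f ∘ x`. -/
def starEval {δ : Germ (𝓤 : Filter ι) ℝ} (hδ : IsPosInfinitesimal δ)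
    (φ : Germ (𝓝 (0 : EuclideanSpace ℝ (Fin n))) ℝ) (ξ : starBall n δ) :
    Germ (𝓤 : Filter ι) ℝ :=
  φ.compTendsto' ξ.1 (tendsto_of_mem_starBall hδ ξ.2)

/-- The transferred supremum exists, and is the least upper bound in `*ℝ`. -/
theorem exists_isLUB_starEval {δ : Germ (𝓤 : Filter ι) ℝ} (hδ : IsPosInfinitesimal δ)
    (φ : germRing n) :
    ∃ s, IsLUB (Set.range fun ξ : starBall n δ => |starEval hδ φ.1 ξ|) s := by
  obtain ⟨φ, -, C, hC⟩ := φ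
  induction φ using Germ.inductionOn with | _ f
  rw [Germ.liftPred_coe] at hC
  obtain ⟨ρ, hρ, hball⟩ := Metric.eventually_nhds_iff.1 hC
  obtain ⟨d, rfl⟩ : ∃ d : ι → ℝ, (d : Germ (𝓤 : Filter ι) ℝ) = δ :=
    Germ.inductionOn δ fun d => ⟨d, rfl⟩
  have hd0 : ∀ᶠ i in (𝓤 : Filter ι), 0 < d i := Germ.coe_lt.1 hδ.1
  have hdρ : ∀ᶠ i in (𝓤 : Filter ι), d i < ρ := Germ.coe_lt.1 (hδ.2 ρ hρ)
  let S : ℝ → Set ℝ := fun t => (fun x => |f x|) '' Metric.closedBall 0 t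
  have hbdd : ∀ t < ρ, BddAbove (S t) := by
    rintro t ht
    refine ⟨C, ?_⟩
    rintro _ ⟨x, hx, rfl⟩
    exact hball (lt_of_le_of_lt hx ht)
  have hne : ∀ t, 0 < t → (S t).Nonempty := fun t ht =>
    ⟨_, 0, Metric.mem_closedBall_self ht.le, rfl⟩
  refine ⟨((fun i => sSup (S (d i)) : ι → ℝ) : Germ (𝓤 : Filter ι) ℝ), ?_, ?_⟩
  · rintro _ ⟨⟨ξ, hξ⟩, rfl⟩
    induction ξ using Germ.inductionOn with | _ x
    have hx : ∀ᶠ i in (𝓤 : Filter ι), ‖x i‖ ≤ d i := Germ.coe_le.1 hξ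
    change |((f ∘ x : ι → ℝ) : Germ (𝓤 : Filter ι) ℝ)| ≤ _
    rw [Germ.abs_def]
    refine Germ.coe_le.2 ?_
    filter_upwards [hx, hdρ] with i h1 h2
    exact le_csSup (hbdd _ h2) ⟨x i, by simpa using h1, rfl⟩
  · intro c hc
    induction c using Germ.inductionOn with | _ c
    refine Germ.coe_le.2 ?_
    by_contra hcon
    replace hcon := Ultrafilter.eventually_not.2 hcon
    have hex : ∀ i, ∃ x : EuclideanSpace ℝ (Fin n), (0 < d i ∧ c i < sSup (S (d i))) →
        ‖x‖ ≤ d i ∧ c i < |f x| := by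
      intro i
      by_cases h : 0 < d i ∧ c i < sSup (S (d i))
      · obtain ⟨_, ⟨x, hx, rfl⟩, hlt⟩ := exists_lt_of_lt_csSup (hne _ h.1) h.2
        exact ⟨x, fun _ => ⟨by simpa using hx, hlt⟩⟩
      · exact ⟨0, fun h' => absurd h' h⟩
    choose x hx using hex
    have hev : ∀ᶠ i in (𝓤 : Filter ι), ‖x i‖ ≤ d i ∧ c i < |f (x i)| := by
      filter_upwards [hd0, hcon] with i h1 h2
      exact hx i ⟨h1, not_le.1 h2⟩
    have hmem : (x : Germ (𝓤 : Filter ι) (EuclideanSpace ℝ (Fin n))) ∈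
        starBall n (d : Germ (𝓤 : Filter ι) ℝ) :=
      Germ.coe_le.2 (hev.mono fun i h => h.1)
    have h1 := hc ⟨⟨_, hmem⟩, rfl⟩
    change |((f ∘ x : ι → ℝ) : Germ (𝓤 : Filter ι) ℝ)| ≤ _ at h1
    rw [Germ.abs_def] at h1
    have h2 : ∀ᶠ i in (𝓤 : Filter ι), |f (x i)| ≤ c i := Germ.coe_le.1 h1
    obtain ⟨i, hi, hi'⟩ := (h2.and hev).exists
    exact absurd hi (not_le.2 hi'.2)

/-- `‖*f‖_δ`, the supremum of `|*f(ξ)|` over `ξ ∈ B_δ`. -/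
def starNorm {δ : Germ (𝓤 : Filter ι) ℝ} (hδ : IsPosInfinitesimal δ) (φ : germRing n) :
    Germ (𝓤 : Filter ι) ℝ :=
  (exists_isLUB_starEval hδ φ).choose

theorem isLUB_starNorm {δ : Germ (𝓤 : Filter ι) ℝ} (hδ : IsPosInfinitesimal δ)
    (φ : germRing n) :
    IsLUB (Set.range fun ξ : starBall n δ => |starEval hδ φ.1 ξ|) (starNorm hδ φ) :=
  (exists_isLUB_starEval hδ φ).choose_spec

/-- The moduli `𝒩_δ = {‖*g‖_δ : [g] ∈ 𝒢₀}`. -/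
def moduli (n : ℕ) {δ : Germ (𝓤 : Filter ι) ℝ} (hδ : IsPosInfinitesimal δ) :
    Set (Germ (𝓤 : Filter ι) ℝ) :=
  Set.range fun g : germRing n => starNorm hδ g

/-- `U_r = {[f] ∈ 𝒢₀ : ‖*f‖_δ < r}`. -/
def basicNhd (n : ℕ) {δ : Germ (𝓤 : Filter ι) ℝ} (hδ : IsPosInfinitesimal δ)
    (r : Germ (𝓤 : Filter ι) ℝ) : Set (germRing n) :=
  {f | starNorm hδ f < r}

/-- The topology `τ = τ^δ` on `𝒢₀`: it is generated by all translates `U_r + [f]` with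
`[f] ∈ 𝒢₀` and positive `r ∈ 𝒩_δ`. -/
@[reducible] def germTopology (n : ℕ) {δ : Germ (𝓤 : Filter ι) ℝ} (hδ : IsPosInfinitesimal δ) :
    TopologicalSpace (germRing n) :=
  TopologicalSpace.generateFrom
    {S | ∃ r ∈ moduli n hδ, 0 < r ∧ ∃ f : germRing n, S = (fun u => u + f) '' basicNhd n hδ r}

end GermTopology

end

/-! The translates are only a subbasis, and the usual argument would need a modulus below the gap `r
- ‖u - f‖`. The proof never looks for one: it keeps `r`, moves the centre and rescales by positive
standard reals, under which the moduli are stable (`isOpen_starNorm_germScale_sub_lt`). For sums, `u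
+ v - f` is the mean of two germs, one in `u` and one in `v`, each equal to `a + b - f` at `(a, b)`.
For products, put `h = a * b - f`; the two conditions `‖c(u - a) ± h‖ < r` give `c|u - a| + |h| < r`
pointwise (`exists_isOpen_abs_add_abs_lt`), and a large standard `c` absorbs the factors, since
germs in `𝒢₀` are bounded by standard reals. -/

namespace GermTopology

variable {ι : Type*} {𝓤 : Ultrafilter ι} {n : ℕ} {δ : Germ (𝓤 : Filter ι) ℝ}

/-- Multiplication of a germ by a real number. -/
def germScale (c : ℝ) (f : germRing n) : germRing n :=
  ⟨c • f.1, by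
    obtain ⟨φ, h0, C, hC⟩ := f
    induction φ using Germ.inductionOn with | _ f
    refine ⟨(congrArg (c * ·) h0 : c * f 0 = c * 0).trans (mul_zero c), |c| * C, ?_⟩
    rw [Germ.liftPred_coe] at hC
    rw [← Germ.coe_smul, Germ.liftPred_coe]
    filter_upwards [hC] with x hx
    rw [Pi.smul_apply, smul_eq_mul, abs_mul]
    exact mul_le_mul_of_nonneg_left hx (abs_nonneg c)⟩

/-! ### Pointwise evaluation and the supremum `starNorm`. -/

section Eval

variable (hδ : IsPosInfinitesimal δ) (f g : germRing n) (ξ : starBall n δ)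

theorem starEval_add : starEval hδ (f + g).1 ξ = starEval hδ f.1 ξ + starEval hδ g.1 ξ := by
  obtain ⟨φ, hφ⟩ := f
  obtain ⟨ψ, hψ⟩ := g
  obtain ⟨ξ, hξ⟩ := ξ
  induction φ using Germ.inductionOn
  induction ψ using Germ.inductionOn
  induction ξ using Germ.inductionOn
  rfl

theorem starEval_mul : starEval hδ (f * g).1 ξ = starEval hδ f.1 ξ * starEval hδ g.1 ξ := by
  obtain ⟨φ, hφ⟩ := f
  obtain ⟨ψ, hψ⟩ := g
  obtain ⟨ξ, hξ⟩ := ξ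
  induction φ using Germ.inductionOn
  induction ψ using Germ.inductionOn
  induction ξ using Germ.inductionOn
  rfl

theorem starEval_neg : starEval hδ (-f).1 ξ = -starEval hδ f.1 ξ := by
  obtain ⟨φ, hφ⟩ := f
  obtain ⟨ξ, hξ⟩ := ξ
  induction φ using Germ.inductionOn
  induction ξ using Germ.inductionOn
  rfl

theorem starEval_sub : starEval hδ (f - g).1 ξ = starEval hδ f.1 ξ - starEval hδ g.1 ξ := by
  rw [sub_eq_add_neg, starEval_add, starEval_neg, sub_eq_add_neg]

theorem starEval_germScale (c : ℝ) :
    starEval hδ (germScale c f).1 ξ = (c : Germ (𝓤 : Filter ι) ℝ) * starEval hδ f.1 ξ := by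
  obtain ⟨φ, hφ⟩ := f
  obtain ⟨ξ, hξ⟩ := ξ
  induction φ using Germ.inductionOn
  induction ξ using Germ.inductionOn
  rfl

theorem abs_starEval_le : |starEval hδ f.1 ξ| ≤ starNorm hδ f :=
  (isLUB_starNorm hδ f).1 ⟨ξ, rfl⟩

variable {f} in
theorem starNorm_le {c : Germ (𝓤 : Filter ι) ℝ} (h : ∀ ξ, |starEval hδ f.1 ξ| ≤ c) :
    starNorm hδ f ≤ c := by
  refine (isLUB_starNorm hδ f).2 ?_
  rintro _ ⟨ξ, rfl⟩
  exact h ξ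

/-- Germs in `𝒢₀` are bounded on `B_δ` by a standard real. -/
theorem exists_starNorm_le : ∃ C : ℝ, 0 < C ∧ starNorm hδ f ≤ (C : Germ (𝓤 : Filter ι) ℝ) := by
  obtain ⟨φ, h0, C, hC⟩ := f
  refine ⟨max C 1, by positivity, starNorm_le hδ fun ξ => ?_⟩
  obtain ⟨ξ, hξ⟩ := ξ
  have ht := tendsto_of_mem_starBall hδ hξ
  induction φ using Germ.inductionOn with | _ f
  induction ξ using Germ.inductionOn with | _ x
  rw [Germ.liftPred_coe] at hC
  rw [Germ.coe_tendsto] at ht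
  change |((f ∘ x : ι → ℝ) : Germ (𝓤 : Filter ι) ℝ)| ≤ ((fun _ => max C 1 : ι → ℝ) :)
  rw [Germ.abs_def]
  refine Germ.coe_le.2 ?_
  filter_upwards [ht.eventually hC] with i hi
  exact hi.trans (le_max_left _ _)

theorem starNorm_zero : starNorm hδ (0 : germRing n) ≤ 0 := by
  refine starNorm_le hδ fun ξ => ?_
  have h := starEval_sub hδ (0 : germRing n) 0 ξ
  rw [sub_zero, sub_self] at h
  rw [h, abs_zero]

-- A nonzero germ is nonzero somewhere in every real ball about `0`; choosing such a point in the
-- ball of radius `d i` for each index gives a point of `B_δ`.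
variable {f} in
theorem starNorm_pos (hf : f ≠ 0) : 0 < starNorm hδ f := by
  have key : ∃ ξ : starBall n δ, starEval hδ f.1 ξ ≠ 0 := by
    obtain ⟨φ, hφ⟩ := f
    replace hf : φ ≠ 0 := fun h => hf (Subtype.ext h)
    induction φ using Germ.inductionOn with | _ f
    obtain ⟨d, rfl⟩ : ∃ d : ι → ℝ, (d : Germ (𝓤 : Filter ι) ℝ) = δ :=
      Germ.inductionOn δ fun d => ⟨d, rfl⟩
    have hd0 : ∀ᶠ i in (𝓤 : Filter ι), 0 < d i := Germ.coe_lt.1 hδ.1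
    have hex : ∀ i, ∃ x : EuclideanSpace ℝ (Fin n), 0 < d i → ‖x‖ ≤ d i ∧ f x ≠ 0 := by
      intro i
      by_contra! hcon
      obtain ⟨hi, -⟩ := hcon 0
      refine hf (Germ.coe_eq.2 ?_)
      filter_upwards [Metric.closedBall_mem_nhds 0 hi] with x hx
      exact (hcon x).2 (by simpa using hx)
    choose x hx using hex
    refine ⟨⟨(x : Germ (𝓤 : Filter ι) _), Germ.coe_le.2 (hd0.mono fun i hi => (hx i hi).1)⟩, ?_⟩
    intro h
    have h' : ∀ᶠ i in (𝓤 : Filter ι), f (x i) = 0 := Germ.coe_eq.1 h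
    obtain ⟨i, hi, hi'⟩ := (h'.and hd0).exists
    exact (hx i hi').2 hi
  obtain ⟨ξ, hξ⟩ := key
  exact (abs_pos.2 hξ).trans_le (abs_starEval_le hδ f ξ)

theorem starNorm_germScale {c : ℝ} (hc : 0 < c) :
    starNorm hδ (germScale c f) = (c : Germ (𝓤 : Filter ι) ℝ) * starNorm hδ f := by
  have hc' : (0 : Germ (𝓤 : Filter ι) ℝ) < (c : Germ (𝓤 : Filter ι) ℝ) := Germ.const_lt hc
  apply le_antisymm
  · refine starNorm_le hδ fun ξ => ?_
    rw [starEval_germScale, abs_mul, abs_of_pos hc']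
    exact mul_le_mul_of_nonneg_left (abs_starEval_le hδ f ξ) hc'.le
  · rw [← le_div_iff₀' hc']
    refine starNorm_le hδ fun ξ => ?_
    rw [le_div_iff₀' hc', ← abs_of_pos hc', ← abs_mul, ← starEval_germScale]
    exact abs_starEval_le hδ _ ξ

end Eval

/-! ### Scaling and subbasic open sets. -/

theorem germScale_sub (c : ℝ) (f g : germRing n) :
    germScale c (f - g) = germScale c f - germScale c g :=
  Subtype.ext (smul_sub c f.1 g.1)

theorem germScale_germScale_inv {c : ℝ} (hc : c ≠ 0) (f : germRing n) :
    germScale c (germScale c⁻¹ f) = f :=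
  Subtype.ext (smul_inv_smul₀ hc f.1)

theorem mul_mem_moduli (hδ : IsPosInfinitesimal δ) {c : ℝ} (hc : 0 < c)
    {r : Germ (𝓤 : Filter ι) ℝ} (hr : r ∈ moduli n hδ) :
    (c : Germ (𝓤 : Filter ι) ℝ) * r ∈ moduli n hδ := by
  obtain ⟨g, rfl⟩ := hr
  exact ⟨germScale c g, starNorm_germScale hδ g hc⟩

theorem image_add_basicNhd (hδ : IsPosInfinitesimal δ) (f : germRing n)
    (r : Germ (𝓤 : Filter ι) ℝ) :
    (fun u => u + f) '' basicNhd n hδ r = {u | starNorm hδ (u - f) < r} := by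
  ext u
  refine ⟨?_, fun hu => ⟨u - f, hu, sub_add_cancel u f⟩⟩
  rintro ⟨v, hv, rfl⟩
  simpa [basicNhd] using hv

theorem isOpen_starNorm_sub_lt (hδ : IsPosInfinitesimal δ) {r : Germ (𝓤 : Filter ι) ℝ}
    (hr : r ∈ moduli n hδ) (hr0 : 0 < r) (f : germRing n) :
    IsOpen[germTopology n hδ] {u | starNorm hδ (u - f) < r} :=
  TopologicalSpace.isOpen_generateFrom_of_mem ⟨r, hr, hr0, f, (image_add_basicNhd hδ f r).symm⟩

/-- Dividing by `c` turns this set into the subbasic one with centre `c⁻¹ f` and modulus `c⁻¹ r`. -/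
theorem isOpen_starNorm_germScale_sub_lt (hδ : IsPosInfinitesimal δ)
    {r : Germ (𝓤 : Filter ι) ℝ} (hr : r ∈ moduli n hδ) (hr0 : 0 < r) (f : germRing n)
    {c : ℝ} (hc : 0 < c) :
    IsOpen[germTopology n hδ] {u | starNorm hδ (germScale c u - f) < r} := by
  have hc' : (0 : Germ (𝓤 : Filter ι) ℝ) < (c⁻¹ : ℝ) := Germ.const_lt (inv_pos.2 hc)
  convert isOpen_starNorm_sub_lt hδ (mul_mem_moduli hδ (inv_pos.2 hc) hr) (mul_pos hc' hr0)
    (germScale c⁻¹ f) using 1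
  ext u
  have h : germScale c⁻¹ (germScale c u - f) = u - germScale c⁻¹ f := by
    rw [germScale_sub]
    congr 1
    simpa using germScale_germScale_inv (inv_ne_zero hc.ne') u
  rw [Set.mem_ofPred_eq, Set.mem_ofPred_eq, ← h, starNorm_germScale hδ _ (inv_pos.2 hc)]
  exact (mul_lt_mul_iff_right₀ hc').symm

/-! ### Continuity of the ring operations. -/

/-- A map of two variables into `𝒢₀` is continuous if the preimages of the translates `U_r + [f]`
contain boxes of open sets. -/
theorem continuous_uncurry_of_boxes (hδ : IsPosInfinitesimal δ)
    (op : germRing n → germRing n → germRing n)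
    (h : ∀ r ∈ moduli n hδ, 0 < r → ∀ f a b : germRing n, starNorm hδ (op a b - f) < r →
      ∃ s t : Set (germRing n), IsOpen[germTopology n hδ] s ∧ IsOpen[germTopology n hδ] t ∧
        a ∈ s ∧ b ∈ t ∧ ∀ u ∈ s, ∀ v ∈ t, starNorm hδ (op u v - f) < r) :
    letI := germTopology n hδ
    Continuous fun p : germRing n × germRing n => op p.1 p.2 := by
  let _ := germTopology n hδ
  refine continuous_generateFrom_iff.2 ?_
  rintro _ ⟨r, hr, hr0, f, rfl⟩
  rw [image_add_basicNhd, isOpen_prod_iff]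
  intro a b hab
  obtain ⟨s, t, hs, ht, has, hbt, hst⟩ := h r hr hr0 f a b hab
  exact ⟨s, t, hs, ht, has, hbt, fun p hp => hst _ hp.1 _ hp.2⟩

theorem continuous_add_germRing (hδ : IsPosInfinitesimal δ) :
    letI := germTopology n hδ
    Continuous fun p : germRing n × germRing n => p.1 + p.2 := by
  refine continuous_uncurry_of_boxes hδ (· + ·) fun r hr hr0 f a b hab => ?_
  have two (x : germRing n) : germScale 2 x = x + x := Subtype.ext (two_smul ℝ x.1)
  -- The centres make both `2u - (a - b + f)` at `u = a` and `2v - (b - a + f)` at `v = b` equal to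
  -- `a + b - f`.
  refine ⟨_, _, isOpen_starNorm_germScale_sub_lt hδ hr hr0 (a - b + f) two_pos,
    isOpen_starNorm_germScale_sub_lt hδ hr hr0 (b - a + f) two_pos, ?_, ?_, ?_⟩
  · rw [Set.mem_ofPred_eq, two]
    convert hab using 2
    abel
  · rw [Set.mem_ofPred_eq, two]
    convert hab using 2
    abel
  · intro u hu v hv
    rw [Set.mem_ofPred_eq] at hu hv
    refine lt_of_le_of_lt (starNorm_le hδ (c := (starNorm hδ (germScale 2 u - (a - b + f)) +
      starNorm hδ (germScale 2 v - (b - a + f))) / 2) fun ξ => ?_) (by linarith)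
    have h1 := abs_starEval_le hδ (germScale 2 u - (a - b + f)) ξ
    have h2 := abs_starEval_le hδ (germScale 2 v - (b - a + f)) ξ
    rw [abs_le] at h1 h2 ⊢
    simp only [two, starEval_sub, starEval_add] at h1 h2 ⊢
    constructor <;> linarith [h1.1, h1.2, h2.1, h2.2]

theorem continuous_neg_germRing (hδ : IsPosInfinitesimal δ) :
    letI := germTopology n hδ
    Continuous fun u : germRing n => -u := by
  let _ := germTopology n hδ
  refine continuous_generateFrom_iff.2 ?_
  rintro _ ⟨r, hr, hr0, f, rfl⟩
  have hneg (u : germRing n) : starNorm hδ (-u) ≤ starNorm hδ u :=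
    starNorm_le hδ fun ξ => by
      rw [starEval_neg, abs_neg]
      exact abs_starEval_le hδ u ξ
  rw [image_add_basicNhd]
  convert isOpen_starNorm_sub_lt hδ hr hr0 (-f) using 1
  ext u
  have h1 := hneg (-u - f)
  have h2 := hneg (u - -f)
  rw [show -(-u - f) = u - -f by abel] at h1
  rw [show -(u - -f) = -u - f by abel] at h2
  exact ⟨h1.trans_lt, h2.trans_lt⟩

/-- If `‖*h‖_δ < r` then `{u : |c (u - a)| + |h| < r uniformly on B_δ}` is a neighbourhood
of `a`. -/
theorem exists_isOpen_abs_add_abs_lt (hδ : IsPosInfinitesimal δ) {r : Germ (𝓤 : Filter ι) ℝ}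
    (hr : r ∈ moduli n hδ) (hr0 : 0 < r) {h : germRing n} (hh : starNorm hδ h < r)
    (a : germRing n) {c : ℝ} (hc : 0 < c) :
    ∃ s : Set (germRing n), IsOpen[germTopology n hδ] s ∧ a ∈ s ∧ ∀ u ∈ s, ∃ q < r, ∀ ξ,
      (c : Germ (𝓤 : Filter ι) ℝ) * |starEval hδ u.1 ξ - starEval hδ a.1 ξ| +
        |starEval hδ h.1 ξ| ≤ q := by
  let _ := germTopology n hδ
  have hc' : (0 : Germ (𝓤 : Filter ι) ℝ) < (c : Germ (𝓤 : Filter ι) ℝ) := Germ.const_lt hc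
  have hneg : starNorm hδ (-h) < r :=
    lt_of_le_of_lt (starNorm_le hδ fun ξ => by
      rw [starEval_neg, abs_neg]
      exact abs_starEval_le hδ h ξ) hh
  refine ⟨_, (isOpen_starNorm_germScale_sub_lt hδ hr hr0 (germScale c a + h) hc).inter
    (isOpen_starNorm_germScale_sub_lt hδ hr hr0 (germScale c a - h) hc), ⟨?_, ?_⟩, ?_⟩
  · simpa using hneg
  · simpa using hh
  · rintro u ⟨hu, hu'⟩
    -- `|x| + |y|` is the larger of `|x - y|` and `|x + y|`, so the larger of the two norms serves
    -- as `q`.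
    refine ⟨_, max_lt hu hu', fun ξ => ?_⟩
    have h1 := (abs_starEval_le hδ (germScale c u - (germScale c a + h)) ξ).trans
      (le_max_left _ (starNorm hδ (germScale c u - (germScale c a - h))))
    have h2 := (abs_starEval_le hδ (germScale c u - (germScale c a - h)) ξ).trans
      (le_max_right (starNorm hδ (germScale c u - (germScale c a + h))) _)
    rw [← abs_of_pos hc', ← abs_mul, mul_sub]
    rw [abs_le] at h1 h2
    simp only [starEval_sub, starEval_add, starEval_germScale] at h1 h2
    obtain ⟨h3, h4⟩ := h1
    obtain ⟨h5, h6⟩ := h2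
    rcases abs_cases ((c : Germ (𝓤 : Filter ι) ℝ) * starEval hδ u.1 ξ -
      (c : Germ (𝓤 : Filter ι) ℝ) * starEval hδ a.1 ξ) with ⟨e, _⟩ | ⟨e, _⟩ <;>
    rcases abs_cases (starEval hδ h.1 ξ) with ⟨e', _⟩ | ⟨e', _⟩ <;>
    rw [e, e'] <;> linarith

theorem continuous_mul_germRing (hδ : IsPosInfinitesimal δ) :
    letI := germTopology n hδ
    Continuous fun p : germRing n × germRing n => p.1 * p.2 := by
  let _ := germTopology n hδ
  refine continuous_uncurry_of_boxes hδ (· * ·) fun r hr hr0 f a b hab => ?_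
  obtain ⟨A, hA0, hA⟩ := exists_starNorm_le hδ a
  obtain ⟨B, hB0, hB⟩ := exists_starNorm_le hδ b
  -- A modulus is the norm of a germ, hence bounded by a standard real.
  obtain ⟨R, hR0, hR⟩ : ∃ R : ℝ, 0 < R ∧ r ≤ (R : Germ (𝓤 : Filter ι) ℝ) := by
    obtain ⟨g, rfl⟩ := hr
    exact exists_starNorm_le hδ g
  have hC : 0 < A + B + R := by positivity
  have hAc : (0 : Germ (𝓤 : Filter ι) ℝ) < A := Germ.const_lt hA0
  have hBc : (0 : Germ (𝓤 : Filter ι) ℝ) < B := Germ.const_lt hB0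
  have hRc : (0 : Germ (𝓤 : Filter ι) ℝ) < R := Germ.const_lt hR0
  have h2C : ((2 * (A + B + R) : ℝ) : Germ (𝓤 : Filter ι) ℝ) =
      2 * ((A : Germ (𝓤 : Filter ι) ℝ) + (B : Germ (𝓤 : Filter ι) ℝ) + R) := rfl
  obtain ⟨s, hs, has, hsu⟩ := exists_isOpen_abs_add_abs_lt hδ hr hr0 hab a (mul_pos two_pos hC)
  obtain ⟨t, ht, hbt, htv⟩ := exists_isOpen_abs_add_abs_lt hδ hr hr0 hab b (mul_pos two_pos hC)
  -- The extra condition on `v` gives `|v| ≤ B + R` on `B_δ`.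
  refine ⟨s, t ∩ {v | starNorm hδ (v - b) < r}, hs,
    ht.inter (isOpen_starNorm_sub_lt hδ hr hr0 b), has, ⟨hbt, ?_⟩, ?_⟩
  · rw [Set.mem_ofPred_eq, sub_self]
    exact (starNorm_zero hδ).trans_lt hr0
  · rintro u hu v ⟨hv, hvb⟩
    obtain ⟨q, hq, hqu⟩ := hsu u hu
    obtain ⟨q', hq', hqv⟩ := htv v hv
    refine lt_of_le_of_lt (starNorm_le hδ (c := (q + q') / 2) fun ξ => ?_) (by linarith)
    have h1 := hqu ξ
    have h2 := hqv ξ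
    have hv1 := (abs_starEval_le hδ (v - b) ξ).trans (hvb.le.trans hR)
    have hb1 := (abs_starEval_le hδ b ξ).trans hB
    have ha1 := (abs_starEval_le hδ a ξ).trans hA
    rw [h2C] at h1 h2
    simp only [starEval_sub, starEval_mul] at h1 h2 hv1 ⊢
    generalize starEval hδ u.1 ξ = x at *
    generalize starEval hδ v.1 ξ = y at *
    generalize starEval hδ a.1 ξ = α at *
    generalize starEval hδ b.1 ξ = β at *
    generalize starEval hδ f.1 ξ = ζ at *
    generalize (A : Germ (𝓤 : Filter ι) ℝ) = A' at *
    generalize (B : Germ (𝓤 : Filter ι) ℝ) = B' at *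
    generalize (R : Germ (𝓤 : Filter ι) ℝ) = R' at *
    have hy : |y| ≤ A' + B' + R' := by
      have := abs_add_le (y - β) β
      rw [sub_add_cancel] at this
      linarith
    have ha2 : |α| ≤ A' + B' + R' := by linarith
    -- With `C = A + B + R` bounding `|y|` and `|α|`, the sum is at most the mean of `2C|x - α| +
    -- |h|` and `2C|y - β| + |h|`, where `h = α * β - ζ`.
    have e : x * y - ζ = (x - α) * y + α * (y - β) + (α * β - ζ) := by ring
    have k1 := abs_add_three ((x - α) * y) (α * (y - β)) (α * β - ζ)
    rw [← e, abs_mul, abs_mul] at k1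
    have k2 := mul_le_mul_of_nonneg_left hy (abs_nonneg (x - α))
    have k3 := mul_le_mul_of_nonneg_right ha2 (abs_nonneg (y - β))
    linarith

/-! ### Separation, by balls of radius half of `‖f - g‖`, again a modulus. -/

theorem t2Space_germTopology (hδ : IsPosInfinitesimal δ) :
    @T2Space (germRing n) (germTopology n hδ) := by
  let _ := germTopology n hδ
  refine ⟨fun f g hfg => ?_⟩
  have hpos := starNorm_pos hδ (sub_ne_zero.2 hfg)
  have hhalf : ((2⁻¹ : ℝ) : Germ (𝓤 : Filter ι) ℝ) = 2⁻¹ := rfl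
  have hr := mul_mem_moduli hδ (inv_pos.2 two_pos) ⟨f - g, rfl⟩
  have hr0 : 0 < ((2⁻¹ : ℝ) : Germ (𝓤 : Filter ι) ℝ) * starNorm hδ (f - g) :=
    mul_pos (Germ.const_lt (inv_pos.2 two_pos)) hpos
  refine ⟨_, _, isOpen_starNorm_sub_lt hδ hr hr0 f, isOpen_starNorm_sub_lt hδ hr hr0 g, ?_, ?_,
    Set.disjoint_left.2 fun u hu hu' => ?_⟩
  · rw [Set.mem_ofPred_eq, sub_self]
    exact (starNorm_zero hδ).trans_lt hr0
  · rw [Set.mem_ofPred_eq, sub_self]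
    exact (starNorm_zero hδ).trans_lt hr0
  · rw [Set.mem_ofPred_eq, hhalf] at hu hu'
    have : starNorm hδ (f - g) ≤ starNorm hδ (u - f) + starNorm hδ (u - g) := by
      refine starNorm_le hδ fun ξ => ?_
      have h1 := abs_starEval_le hδ (u - f) ξ
      have h2 := abs_starEval_le hδ (u - g) ξ
      rw [abs_le] at h1 h2 ⊢
      simp only [starEval_sub] at h1 h2 ⊢
      constructor <;> linarith [h1.1, h1.2, h2.1, h2.2]
    linarith

end GermTopology

theorem mainTheorem11 (n : ℕ) {ι : Type*} (𝓤 : Ultrafilter ι) (δ : Germ (𝓤 : Filter ι) ℝ)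
    (hδ : GermTopology.IsPosInfinitesimal δ) :
    @IsTopologicalRing (GermTopology.germRing n) (GermTopology.germTopology n hδ) inferInstance ∧
      @T2Space (GermTopology.germRing n) (GermTopology.germTopology n hδ) := by
  let _ := GermTopology.germTopology n hδ
  exact ⟨{ continuous_add := GermTopology.continuous_add_germRing hδ
           continuous_mul := GermTopology.continuous_mul_germRing hδ
           continuous_neg := GermTopology.continuous_neg_germRing hδ },
    GermTopology.t2Space_germTopology hδ⟩
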